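/- Let $n<\omega$. For a regular (infinite) cardinal $\kappa$, a set $S\subseteq\kappa$ is called a $\Pi^1_n$-indescribable subset of $\kappa$ if for every $A\subseteq V_\kappa$ and every $\Pi^1_n$-sentence $\varphi$ such that $(V_\kappa,\in,A)\models\varphi$ there is $\alpha\in S$ with $(V_\alpha,\in,A\cap V_\alpha)\models\varphi$. Write $\Pi^1_n(\kappa)^+$ for the collection of $\Pi^1_n$-indescribable subsets of $\kappa$ and $\Pi^1_n(\kappa)$ for the collection of all other subsets of $\kappa$; if $\kappa$ is not a regular cardinal, put $\Pi^1_n(\kappa)^+=\emptyset$. The cardinal $\kappa$ is $\Pi^1_n$-indescribable if $\kappa\in\Pi^1_n(\kappa)^+$. The principle $\mathrm{Refl}_n(\kappa)$ says that $\kappa$ is $\Pi^1_n$-indescribable and for every $S\in\Pi^1_n(\kappa)^+$ there is $\gamma<\kappa$ with $S\cap\gamma\in\Pi^1_n(\gamma)^+$. For $X\subseteq\kappa$ let $\mathrm{Tr}_n(X)=\{\alpha<\kappa: X\cap\alpha\in\Pi^1_n(\alpha)^+\}$, and let $\mathrm{Tr}_n^m$ be its $m$-th iterate. Suppose $\mathrm{Refl}_n(\kappa)$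 holds. Then: 1. the set $\mathrm{Ind}^1_n\cap\kappa=\{\alpha<\kappa:\alpha\text{ is a }\Pi^1_n\text{-indescribable cardinal}\}$ is a $\Pi^1_n$-indescribable subset of $\kappa$; 2. for every $m<\omega$, $\mathrm{Tr}_n^m(\mathrm{Ind}^1_n\cap\kappa)\in\Pi^1_n(\kappa)^+$; 3. $\kappa$ is $\omega$-$\Pi^1_n$-indescribable, that is, for every $m<\omega$ we have $\mathrm{Tr}_n^m([\kappa]_n)>0$ in $\mathscr P(\kappa)/\Pi^1_n(\kappa)$, where $[A]_n=[B]_n$ iff $A\mathbin{\triangle}B\in\Pi^1_n(\kappa)$, and $\mathrm{Tr}_n([A]_n)=[\mathrm{Tr}_n(A)]_n$. Explicitly: whenever $A_0,\dots,A_m\subseteq\kappa$ satisfy $[A_0]_n=[\kappa]_n$ and $[A_{i+1}]_n=[\mathrm{Tr}_n(A_i)]_n$ for all $i<m$, then $A_m\in\Pi^1_n(\kappa)^+$. -/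

import Mathlib

open scoped ZFSet

universe u

namespace Indescribability

/-- Relation symbols of the language of set theory with `k` extra unary predicates: the binary
membership symbol and unary predicate symbols indexed by `Fin k`. -/
inductive SetRel (k : ℕ) : ℕ → Type
  | mem : SetRel k 2
  | pred (i : Fin k) : SetRel k 1

/-- The first-order language of set theory with `k` extra unary predicate symbols. -/
def setLang (k : ℕ) : FirstOrder.Language := ⟨fun _ => Empty, SetRel k⟩

/-- The structure `(V_α, ∈, P 0, …, P (k - 1))`, where each `P i` is a set used as a unary
predicate on `V_α`. -/
@[reducible]
def vStructure (α : Ordinal.{u}) {k : ℕ} (P : Fin k → ZFSet.{u}) :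
    (setLang k).Structure {x : ZFSet.{u} // x ∈ V_ α} where
  funMap f := f.elim
  RelMap := fun {_} r =>
    match r with
    | SetRel.mem => fun v => (v 0).1 ∈ (v 1).1
    | SetRel.pred i => fun v => (v 0).1 ∈ P i

/-- Prenex second-order formulas in the language of set theory, with `k` free second-order
variables (unary predicates) and no free first-order variable: a string of second-order quantifiers
in front of a first-order sentence. In `all φ` and `ex φ` the bound second-order variable is number
`0` of `φ`, and the free variable `i` of the whole formula is number `i + 1` of `φ`. -/
inductive SOFormula : ℕ → Type
  | fo {k : ℕ} (φ : (setLang k).Sentence) : SOFormula k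
  | all {k : ℕ} (φ : SOFormula (k + 1)) : SOFormula k
  | ex {k : ℕ} (φ : SOFormula (k + 1)) : SOFormula k

/-- Satisfaction of a second-order formula in `(V_α, ∈, P 0, …, P (k - 1))`, with full semantics:
second-order quantifiers range over all subsets of `V_α`. -/
def Sat (α : Ordinal.{u}) : {k : ℕ} → SOFormula k → (Fin k → ZFSet.{u}) → Prop
  | k, .fo φ, P => @FirstOrder.Language.Sentence.Realize (setLang k) _ (vStructure α P) φ
  | _, .all φ, P => ∀ X : ZFSet.{u}, X ⊆ V_ α → Sat α φ (Fin.cons X P)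
  | _, .ex φ, P => ∃ X : ZFSet.{u}, X ⊆ V_ α ∧ Sat α φ (Fin.cons X P)

/-- The two kinds of levels `Π¹ₙ` and `Σ¹ₙ` of the second-order hierarchy. -/
inductive Kind
  | pi
  | sigma

/-- Exchanges `Π` and `Σ`. -/
def Kind.dual : Kind → Kind
  | .pi => .sigma
  | .sigma => .pi

/-- `InLevel .pi n φ` says that `φ` is a `Π¹ₙ` formula and `InLevel .sigma n φ` that it is a `Σ¹ₙ`
formula. Level `0` consists of the first-order formulas; a `Π¹ₙ₊₁` formula is a (possibly empty)
block of universal second-order quantifiers followed by a `Σ¹ₙ` formula, and dually. -/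
inductive InLevel : Kind → ℕ → {k : ℕ} → SOFormula k → Prop
  | fo (q : Kind) {k : ℕ} (φ : (setLang k).Sentence) : InLevel q 0 (SOFormula.fo φ)
  | step {q : Kind} {n k : ℕ} {φ : SOFormula k} : InLevel q.dual n φ → InLevel q (n + 1) φ
  | all {n k : ℕ} {φ : SOFormula (k + 1)} :
      InLevel .pi (n + 1) φ → InLevel .pi (n + 1) (SOFormula.all φ)
  | ex {n k : ℕ} {φ : SOFormula (k + 1)} :
      InLevel .sigma (n + 1) φ → InLevel .sigma (n + 1) (SOFormula.ex φ)

/-- The ordinal `α` is a regular (infinite) cardinal. -/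
def IsRegularCardinal (α : Ordinal.{u}) : Prop :=
  ∃ c : Cardinal.{u}, c.IsRegular ∧ c.ord = α

/-- `S` is a `Π¹ₙ`-indescribable subset of `κ`, that is, `κ` is a regular cardinal and
`S ∈ Π¹ₙ(κ)⁺`. Ordinals are identified with the sets `Set.Iio κ` of their predecessors. -/
def IsIndescribableSubset (n : ℕ) (κ : Ordinal.{u}) (S : Set Ordinal.{u}) : Prop :=
  IsRegularCardinal κ ∧ S ⊆ Set.Iio κ ∧
    ∀ (A : ZFSet.{u}) (φ : SOFormula 1), A ⊆ V_ κ → InLevel .pi n φ →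
      Sat κ φ (fun _ => A) → ∃ α ∈ S, Sat α φ (fun _ => A ∩ V_ α)

/-- `κ` is a `Π¹ₙ`-indescribable cardinal. -/
def IsIndescribable (n : ℕ) (κ : Ordinal.{u}) : Prop :=
  IsIndescribableSubset n κ (Set.Iio κ)

/-- The set of `Π¹ₙ`-indescribable cardinals below `κ`. -/
def Ind (n : ℕ) (κ : Ordinal.{u}) : Set Ordinal.{u} :=
  {α | α < κ ∧ IsIndescribable n α}

/-- The `Π¹ₙ`-reflection principle at `κ`. -/
def Refl (n : ℕ) (κ : Ordinal.{u}) : Prop :=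
  IsIndescribable n κ ∧
    ∀ S : Set Ordinal.{u}, IsIndescribableSubset n κ S →
      ∃ γ < κ, IsIndescribableSubset n γ (S ∩ Set.Iio γ)

/-- The trace operation on subsets of `κ`: `Trₙ(X) = {α < κ : X ∩ α ∈ Π¹ₙ(α)⁺}`. -/
def Tr (n : ℕ) (κ : Ordinal.{u}) (X : Set Ordinal.{u}) : Set Ordinal.{u} :=
  {α | α < κ ∧ IsIndescribableSubset n α (X ∩ Set.Iio α)}

/-- Subsets `A` and `B` of `κ` have the same class in `P(κ)/Π¹ₙ(κ)`: their symmetric difference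
is not a `Π¹ₙ`-indescribable subset of `κ`. -/
def EqMod (n : ℕ) (κ : Ordinal.{u}) (A B : Set Ordinal.{u}) : Prop :=
  A ⊆ Set.Iio κ ∧ B ⊆ Set.Iio κ ∧ ¬ IsIndescribableSubset n κ ((A \ B) ∪ (B \ A))

/-- `A` represents the element `Trₙᵐ([κ]ₙ)` of `P(κ)/Π¹ₙ(κ)`, where `Trₙ([B]ₙ) = [Trₙ(B)]ₙ`. -/
inductive RepresentsTr (n : ℕ) (κ : Ordinal.{u}) : ℕ → Set Ordinal.{u} → Prop
  | zero {A : Set Ordinal.{u}} : EqMod n κ A (Set.Iio κ) → RepresentsTr n κ 0 A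
  | succ {m : ℕ} {A B : Set Ordinal.{u}} :
      RepresentsTr n κ m B → EqMod n κ A (Tr n κ B) → RepresentsTr n κ (m + 1) A

/-- `κ` is `ω`-`Π¹ₙ`-indescribable: for every `m < ω` the element `Trₙᵐ([κ]ₙ)` of `P(κ)/Π¹ₙ(κ)` is
nonzero, that is, its representatives are `Π¹ₙ`-indescribable subsets of `κ`. -/
def IsOmegaIndescribable (n : ℕ) (κ : Ordinal.{u}) : Prop :=
  ∀ (m : ℕ) (A : Set Ordinal.{u}), RepresentsTr n κ m A → IsIndescribableSubset n κ A

end Indescribability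

namespace Indescribability
open FirstOrder FirstOrder.Language

/-! Everything follows from one fact, `Refl.tr`: under reflection, the trace of an indescribable set
`S` is indescribable. Let a `Π¹ₙ` sentence `φ` hold at `κ`. The points of `S` where `φ` holds still
form an indescribable set (`sep`), so reflection gives `γ < κ` where this set is indescribable in
`γ`. Then `γ` is in the trace, and `φ` holds at `γ`: otherwise its negation, being `Σ¹ₙ₊₁`, would
reflect to a point chosen to satisfy `φ`. Iterating from `κ` itself, whose trace is `Ind n κ`, gives
the first two claims. For the third, positivity passes to any equivalent set because the
non-indescribable sets form an ideal.

The remaining work is syntactic. Conjunctions must stay in their level, and several predicates must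
be coded into the single one that the definition allows. -/

/-! ### Substituting definitions for predicates -/

theorem exists_var_of_term {k : ℕ} {β : Type*} (t : (setLang k).Term β) :
    ∃ a, t = Term.var a := by
  cases t with
  | var a => exact ⟨a, rfl⟩
  | func f _ => exact f.elim

/-- `P i` is defined on `V_α` by the formula `I i` with predicates `Q`. -/
def Interprets (α : Ordinal.{u}) {k l : ℕ} (I : Fin k → (setLang l).Formula (Fin 1))
    (P : Fin k → ZFSet.{u}) (Q : Fin l → ZFSet.{u}) : Prop :=
  ∀ i, ∀ x : {x : ZFSet.{u} // x ∈ V_ α},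
    x.1 ∈ P i ↔ @Formula.Realize _ _ (vStructure α Q) _ (I i) fun _ => x

theorem exists_boundedFormula_of_interprets {k l : ℕ} {β : Type*}
    (I : Fin k → (setLang l).Formula (Fin 1)) {m : ℕ} (φ : (setLang k).BoundedFormula β m) :
    ∃ φ' : (setLang l).BoundedFormula β m, ∀ (α : Ordinal.{u}) (P : Fin k → ZFSet.{u})
      (Q : Fin l → ZFSet.{u}), Interprets α I P Q → ∀ v xs,
        @BoundedFormula.Realize _ _ (vStructure α Q) _ _ φ' v xs ↔
          @BoundedFormula.Realize _ _ (vStructure α P) _ _ φ v xs := by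
  induction φ with
  | falsum => exact ⟨.falsum, fun _ _ _ _ _ _ => Iff.rfl⟩
  | equal t s =>
    obtain ⟨a, rfl⟩ := exists_var_of_term t
    obtain ⟨b, rfl⟩ := exists_var_of_term s
    exact ⟨.equal (.var a) (.var b), fun _ _ _ _ _ _ => Iff.rfl⟩
  | @rel n j R ts =>
    choose a ha using fun i => exists_var_of_term (ts i)
    obtain rfl : ts = fun i => Term.var (a i) := funext ha
    cases R with
    | mem => exact ⟨.rel (SetRel.mem : (setLang l).Relations 2) fun i => .var (a i),
        fun _ _ _ _ _ _ => Iff.rfl⟩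
    | pred i =>
      refine ⟨BoundedFormula.relabel (k := 0) (fun _ => a 0) (I i), fun α P Q h v xs => ?_⟩
      let := vStructure α Q
      refine (BoundedFormula.realize_relabel (φ := I i) (g := fun _ => a 0)).trans ?_
      refine Iff.trans ?_ (h i (Sum.elim v xs (a 0))).symm
      rw [Formula.Realize]
      refine iff_of_eq ?_
      congr!
  | imp φ ψ ih₁ ih₂ =>
    obtain ⟨φ', h₁⟩ := ih₁
    obtain ⟨ψ', h₂⟩ := ih₂
    refine ⟨φ'.imp ψ', fun α P Q h v xs => ?_⟩
    simp only [BoundedFormula.realize_imp, h₁ α P Q h, h₂ α P Q h]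
  | all φ ih =>
    obtain ⟨φ', h₁⟩ := ih
    refine ⟨φ'.all, fun α P Q h v xs => ?_⟩
    simp only [BoundedFormula.realize_all, h₁ α P Q h]

/-- The formula expressing that the variable satisfies the `i`-th predicate. -/
def predFormula {l : ℕ} (i : Fin l) : (setLang l).Formula (Fin 1) :=
  Relations.formula₁ (SetRel.pred i : (setLang l).Relations 1) (.var 0)

theorem realize_predFormula {l : ℕ} (i : Fin l) (α : Ordinal.{u}) (Q : Fin l → ZFSet.{u})
    (x : {x : ZFSet.{u} // x ∈ V_ α}) :
    @Formula.Realize _ _ (vStructure α Q) _ (predFormula i) (fun _ => x) ↔ x.1 ∈ Q i :=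
  Iff.rfl

theorem InLevel.exists_of_interprets {q : Kind} {n k : ℕ} {φ : SOFormula k}
    (hφ : InLevel q n φ) {l : ℕ} (I : Fin k → (setLang l).Formula (Fin 1)) :
    ∃ φ' : SOFormula l, InLevel q n φ' ∧ ∀ (α : Ordinal.{u}) (P : Fin k → ZFSet.{u})
      (Q : Fin l → ZFSet.{u}), Interprets α I P Q → (Sat α φ' Q ↔ Sat α φ P) := by
  have lift : ∀ {k l : ℕ} (I : Fin k → (setLang l).Formula (Fin 1)),
      ∃ J : Fin (k + 1) → (setLang (l + 1)).Formula (Fin 1),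
      ∀ (α : Ordinal.{u}) (P : Fin k → ZFSet.{u}) (Q : Fin l → ZFSet.{u}), Interprets α I P Q →
        ∀ X : ZFSet.{u}, Interprets α J (Fin.cons X P : Fin (k + 1) → ZFSet.{u})
          (Fin.cons X Q : Fin (l + 1) → ZFSet.{u}) := by
    intro k l I
    choose J hJ using fun i => exists_boundedFormula_of_interprets.{u}
      (fun j : Fin l => predFormula j.succ) (I i)
    -- Under a second-order quantifier the newly bound predicate defines itself, and the old
    -- definitions are shifted by one.
    refine ⟨Fin.cons (predFormula 0) J, fun α P Q h X i x => ?_⟩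
    cases i using Fin.cases with
    | zero => exact (realize_predFormula 0 α _ x).symm
    | succ i =>
      exact (h i x).trans (hJ i α Q (Fin.cons X Q : Fin (l + 1) → ZFSet.{u})
        (fun j y => (realize_predFormula j.succ α (Fin.cons X Q : Fin (l + 1) → ZFSet.{u}) y).symm) _ _).symm
  induction hφ generalizing l with
  | fo q φ =>
    obtain ⟨φ', h⟩ := exists_boundedFormula_of_interprets.{u} I φ
    exact ⟨.fo φ', .fo q φ', fun α P Q hPQ => h α P Q hPQ _ _⟩
  | step _ ih =>
    obtain ⟨φ', h, h'⟩ := ih I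
    exact ⟨φ', h.step, h'⟩
  | all _ ih =>
    obtain ⟨J, hJ⟩ := lift I
    obtain ⟨φ', h, h'⟩ := ih J
    exact ⟨φ'.all, h.all, fun α P Q hPQ =>
      forall₂_congr fun X _ => h' α _ _ (hJ α P Q hPQ X)⟩
  | ex _ ih =>
    obtain ⟨J, hJ⟩ := lift I
    obtain ⟨φ', h, h'⟩ := ih J
    exact ⟨φ'.ex, h.ex, fun α P Q hPQ =>
      exists_congr fun X => and_congr_right fun _ => h' α _ _ (hJ α P Q hPQ X)⟩

theorem InLevel.exists_rename {q : Kind} {n k : ℕ} {φ : SOFormula k}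
    (hφ : InLevel q n φ) {l : ℕ} (f : Fin k → Fin l) :
    ∃ φ' : SOFormula l, InLevel q n φ' ∧ ∀ (α : Ordinal.{u}) (Q : Fin l → ZFSet.{u}),
      Sat α φ' Q ↔ Sat α φ fun i => Q (f i) := by
  obtain ⟨φ', h, h'⟩ := hφ.exists_of_interprets.{u} fun i => predFormula (f i)
  exact ⟨φ', h, fun α Q => h' α _ Q fun i x => (realize_predFormula (f i) α Q x).symm⟩

/-! ### Closure properties of the levels -/

theorem InLevel.succ {q : Kind} {n k : ℕ} {φ : SOFormula k} (h : InLevel q n φ) :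
    InLevel q (n + 1) φ := by
  induction h with
  | fo q φ => exact .step (.fo _ φ)
  | step _ ih => exact ih.step
  | all _ ih => exact ih.all
  | ex _ ih => exact ih.ex

theorem InLevel.fo_level (q : Kind) (n : ℕ) {k : ℕ} (φ : (setLang k).Sentence) :
    InLevel q n (SOFormula.fo φ) := by
  induction n with
  | zero => exact .fo q φ
  | succ n ih => exact ih.succ

theorem InLevel.exists_not {q : Kind} {n k : ℕ} {φ : SOFormula k} (h : InLevel q n φ) :
    ∃ φ' : SOFormula k, InLevel q.dual n φ' ∧ ∀ (α : Ordinal.{u}) (P : Fin k → ZFSet.{u}),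
      Sat α φ' P ↔ ¬ Sat α φ P := by
  induction h with
  | fo q φ =>
    exact ⟨.fo φ.not, .fo _ _, fun α P => Iff.rfl⟩
  | step _ ih =>
    obtain ⟨φ', h, h'⟩ := ih
    exact ⟨φ', h.step, h'⟩
  | all _ ih =>
    obtain ⟨φ', h, h'⟩ := ih
    refine ⟨φ'.ex, h.ex, fun α P => ?_⟩
    simp only [Sat, h', not_forall, exists_prop]
  | ex _ ih =>
    obtain ⟨φ', h, h'⟩ := ih
    refine ⟨φ'.all, h.all, fun α P => ?_⟩
    simp only [Sat, h', not_exists, not_and]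

/-- The leading quantifier blocks of `φ` and then of `ψ` are pulled out, renaming the other conjunct
each time. What remains is a conjunction one level down, of the dual kind. -/
theorem exists_and {q : Kind} {n k : ℕ} {φ ψ : SOFormula k} (hφ : InLevel q n φ)
    (hψ : InLevel q n ψ) :
    ∃ χ : SOFormula k, InLevel q n χ ∧ ∀ (α : Ordinal.{u}) (P : Fin k → ZFSet.{u}),
      Sat α χ P ↔ Sat α φ P ∧ Sat α ψ P := by
  induction n generalizing q k with
  | zero =>
    cases hφ with
    | fo _ φ =>
    cases hψ with
    | fo _ ψ =>
    refine ⟨.fo (φ ⊓ ψ), .fo _ _, fun α P => ?_⟩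
    let := vStructure α P
    exact BoundedFormula.realize_inf
  | succ n ih =>
    have left : ∀ {q : Kind} {m k : ℕ} {ψ : SOFormula k}, InLevel q m ψ → m = n + 1 →
        ∀ {φ : SOFormula k}, InLevel q.dual n φ →
        ∃ χ : SOFormula k, InLevel q (n + 1) χ ∧ ∀ (α : Ordinal.{u}) (P : Fin k → ZFSet.{u}),
          Sat α χ P ↔ Sat α φ P ∧ Sat α ψ P := by
      intro q m k ψ hψ hm φ hφ
      induction hψ with
      | fo => cases hm
      | step hψ =>
        cases hm
        obtain ⟨χ, h, h'⟩ := ih hφ hψ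
        exact ⟨χ, h.step, h'⟩
      | all _ ih' =>
        obtain ⟨φ₁, h₁, h₁'⟩ := hφ.exists_rename.{u} Fin.succ
        obtain ⟨χ, h, h'⟩ := ih' hm h₁
        refine ⟨χ.all, h.all, fun α P => ?_⟩
        simp only [Sat, h', h₁', Fin.cons_succ]
        -- The quantifier is vacuous for the other conjunct, so any instance will do.
        exact ⟨fun H => ⟨(H ∅ (ZFSet.empty_subset _)).1, fun X hX => (H X hX).2⟩,
          fun H X hX => ⟨H.1, H.2 X hX⟩⟩
      | ex _ ih' =>
        obtain ⟨φ₁, h₁, h₁'⟩ := hφ.exists_rename.{u} Fin.succ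
        obtain ⟨χ, h, h'⟩ := ih' hm h₁
        refine ⟨χ.ex, h.ex, fun α P => ?_⟩
        simp only [Sat, h', h₁', Fin.cons_succ]
        tauto
    have main : ∀ {q : Kind} {m k : ℕ} {φ : SOFormula k}, InLevel q m φ → m = n + 1 →
        ∀ {ψ : SOFormula k}, InLevel q (n + 1) ψ →
        ∃ χ : SOFormula k, InLevel q (n + 1) χ ∧ ∀ (α : Ordinal.{u}) (P : Fin k → ZFSet.{u}),
          Sat α χ P ↔ Sat α φ P ∧ Sat α ψ P := by
      intro q m k φ hφ hm ψ hψ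
      induction hφ with
      | fo => cases hm
      | step hφ =>
        cases hm
        exact left hψ rfl hφ
      | all _ ih' =>
        cases hm
        obtain ⟨ψ₁, h₁, h₁'⟩ := hψ.exists_rename.{u} Fin.succ
        obtain ⟨χ, h, h'⟩ := ih' rfl h₁
        refine ⟨χ.all, h.all, fun α P => ?_⟩
        simp only [Sat, h', h₁', Fin.cons_succ]
        exact ⟨fun H => ⟨fun X hX => (H X hX).1, (H ∅ (ZFSet.empty_subset _)).2⟩,
          fun H X hX => ⟨H.1 X hX, H.2⟩⟩
      | ex _ ih' =>
        cases hm
        obtain ⟨ψ₁, h₁, h₁'⟩ := hψ.exists_rename.{u} Fin.succ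
        obtain ⟨χ, h, h'⟩ := ih' rfl h₁
        refine ⟨χ.ex, h.ex, fun α P => ?_⟩
        simp only [Sat, h', h₁', Fin.cons_succ]
        tauto
    exact main hφ rfl hψ

/-! ### Coding two predicates into one -/

/-- The atomic formula `a ∈ b`. -/
def memFormula {k m : ℕ} {β : Type*} (a b : β ⊕ Fin m) : (setLang k).BoundedFormula β m :=
  Relations.boundedFormula₂ (SetRel.mem : (setLang k).Relations 2) (.var a) (.var b)

/-- The atomic formula `a = b`. -/
def eqFormula {k m : ℕ} {β : Type*} (a b : β ⊕ Fin m) : (setLang k).BoundedFormula β m :=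
  .equal (.var a) (.var b)

theorem realize_memFormula {k m : ℕ} {β : Type*} (a b : β ⊕ Fin m) (α : Ordinal.{u})
    (P : Fin k → ZFSet.{u}) (v : β → {x : ZFSet.{u} // x ∈ V_ α}) (xs) :
    @BoundedFormula.Realize _ _ (vStructure α P) _ _ (memFormula a b) v xs ↔
      (Sum.elim v xs a).1 ∈ (Sum.elim v xs b).1 :=
  Iff.rfl

theorem realize_eqFormula {k m : ℕ} {β : Type*} (a b : β ⊕ Fin m) (α : Ordinal.{u})
    (P : Fin k → ZFSet.{u}) (v : β → {x : ZFSet.{u} // x ∈ V_ α}) (xs) :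
    @BoundedFormula.Realize _ _ (vStructure α P) _ _ (eqFormula a b) v xs ↔
      Sum.elim v xs a = Sum.elim v xs b :=
  Iff.rfl

/-- Every set has a singleton. -/
def singletonSentence (k : ℕ) : (setLang k).Sentence :=
  ((((memFormula (.inr 2) (.inr 1)).iff (eqFormula (.inr 2) (.inr 0))).all :
    (setLang k).BoundedFormula Empty 2).ex).all

/-- The singleton of the variable satisfies the predicate `0`. -/
def singletonFormula (k : ℕ) : (setLang (k + 1)).Formula (Fin 1) :=
  ((((memFormula (.inr 1) (.inr 0)).iff (eqFormula (.inr 1) (.inl 0))).all ⊓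
    (Relations.boundedFormula₁ (SetRel.pred 0 : (setLang (k + 1)).Relations 1) (.var (.inr 0)) :
      (setLang (k + 1)).BoundedFormula (Fin 1) 1)).ex)

/-- The set `{x, {x}}`, where `x` is the variable, satisfies the predicate `0`. -/
def pairFormula (k : ℕ) : (setLang (k + 1)).Formula (Fin 1) :=
  ((((memFormula (.inr 1) (.inr 0)).iff (eqFormula (.inr 1) (.inl 0) ⊔
      ((memFormula (.inr 2) (.inr 1)).iff (eqFormula (.inr 2) (.inl 0))).all)).all ⊓
    (Relations.boundedFormula₁ (SetRel.pred 0 : (setLang (k + 1)).Relations 1) (.var (.inr 0)) :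
      (setLang (k + 1)).BoundedFormula (Fin 1) 1)).ex)

theorem mem_vonNeumann_of_mem {α : Ordinal.{u}} {x y : ZFSet.{u}} (h : x ∈ y) (hy : y ∈ V_ α) :
    x ∈ V_ α :=
  (ZFSet.isTransitive_vonNeumann α).mem_trans h hy

theorem eq_singleton_iff_vonNeumann {α : Ordinal.{u}} {x z : ZFSet.{u}} (hx : x ∈ V_ α)
    (hz : z ∈ V_ α) : (∀ w ∈ V_ α, w ∈ z ↔ w = x) ↔ z = {x} := by
  constructor
  · intro h
    ext w
    rw [ZFSet.mem_singleton]
    exact ⟨fun hw => (h w (mem_vonNeumann_of_mem hw hz)).1 hw,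
      fun hw => (h w (hw ▸ hx)).2 hw⟩
  · rintro rfl w -
    exact ZFSet.mem_singleton

theorem sat_singletonSentence {k : ℕ} {α : Ordinal.{u}} {P : Fin k → ZFSet.{u}} :
    Sat α (.fo (singletonSentence k)) P ↔ ∀ x ∈ V_ α, {x} ∈ V_ α := by
  let := vStructure α P
  simp only [Sat, Sentence.Realize, Formula.Realize, singletonSentence, BoundedFormula.realize_all,
    BoundedFormula.realize_ex, BoundedFormula.realize_iff, realize_memFormula, realize_eqFormula,
    Sum.elim_inr]
  refine Iff.trans (b := ∀ x : {x : ZFSet.{u} // x ∈ V_ α}, ∃ z : {x : ZFSet.{u} // x ∈ V_ α},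
    ∀ w : {x : ZFSet.{u} // x ∈ V_ α}, w.1 ∈ z.1 ↔ w = x) Iff.rfl ?_
  simp only [Subtype.forall, Subtype.exists, Subtype.mk.injEq]
  refine forall₂_congr fun x hx => ⟨fun ⟨z, hz, h⟩ => ?_, fun h => ⟨_, h, ?_⟩⟩
  · rwa [← (eq_singleton_iff_vonNeumann hx hz).1 h]
  · exact (eq_singleton_iff_vonNeumann hx h).2 rfl

theorem realize_singletonFormula {k : ℕ} {α : Ordinal.{u}} {P : Fin (k + 1) → ZFSet.{u}}
    (hα : ∀ x ∈ V_ α, {x} ∈ V_ α) (x : {x : ZFSet.{u} // x ∈ V_ α}) :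
    @Formula.Realize _ _ (vStructure α P) _ (singletonFormula k) (fun _ => x) ↔
      {x.1} ∈ P 0 := by
  let := vStructure α P
  simp only [Formula.Realize, singletonFormula, BoundedFormula.realize_all,
    BoundedFormula.realize_ex, BoundedFormula.realize_iff, BoundedFormula.realize_inf,
    realize_memFormula, realize_eqFormula, Sum.elim_inr, Sum.elim_inl]
  refine Iff.trans (b := ∃ z : {x : ZFSet.{u} // x ∈ V_ α},
    (∀ w : {x : ZFSet.{u} // x ∈ V_ α}, w.1 ∈ z.1 ↔ w = x) ∧ z.1 ∈ P 0) Iff.rfl ?_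
  obtain ⟨x, hx⟩ := x
  simp only [Subtype.forall, Subtype.exists, Subtype.mk.injEq]
  constructor
  · rintro ⟨z, hz, h, h'⟩
    rwa [← (eq_singleton_iff_vonNeumann hx hz).1 h]
  · exact fun h => ⟨_, hα x hx, (eq_singleton_iff_vonNeumann hx (hα x hx)).2 rfl, h⟩

theorem pair_singleton_mem_vonNeumann {α : Ordinal.{u}} (hα : ∀ x ∈ V_ α, {x} ∈ V_ α)
    {x : ZFSet.{u}} (hx : x ∈ V_ α) : {x, {x}} ∈ V_ α := by
  have h := hα _ (hα x hx)
  rw [ZFSet.mem_vonNeumann] at h ⊢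
  -- Both elements have rank below that of `{{x}}`, which lies in `V_ α`.
  refine lt_of_le_of_lt ?_ h
  rw [ZFSet.rank_le_iff]
  intro y hy
  have h₁ : ZFSet.rank ({x} : ZFSet.{u}) < ZFSet.rank ({{x}} : ZFSet.{u}) :=
    ZFSet.rank_lt_of_mem (ZFSet.mem_singleton.2 rfl)
  rcases ZFSet.mem_pair.1 hy with rfl | rfl
  · exact (ZFSet.rank_lt_of_mem (ZFSet.mem_singleton.2 rfl)).trans h₁
  · exact h₁

theorem realize_pairFormula {k : ℕ} {α : Ordinal.{u}} {P : Fin (k + 1) → ZFSet.{u}}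
    (hα : ∀ x ∈ V_ α, {x} ∈ V_ α) (x : {x : ZFSet.{u} // x ∈ V_ α}) :
    @Formula.Realize _ _ (vStructure α P) _ (pairFormula k) (fun _ => x) ↔
      {x.1, {x.1}} ∈ P 0 := by
  let := vStructure α P
  simp only [Formula.Realize, pairFormula, BoundedFormula.realize_all,
    BoundedFormula.realize_ex, BoundedFormula.realize_iff, BoundedFormula.realize_inf,
    BoundedFormula.realize_sup,
    realize_memFormula, realize_eqFormula, Sum.elim_inr, Sum.elim_inl]
  refine Iff.trans (b := ∃ z : {x : ZFSet.{u} // x ∈ V_ α},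
    (∀ w : {x : ZFSet.{u} // x ∈ V_ α}, w.1 ∈ z.1 ↔ (w = x ∨
      ∀ v : {x : ZFSet.{u} // x ∈ V_ α}, v.1 ∈ w.1 ↔ v = x)) ∧ z.1 ∈ P 0) Iff.rfl ?_
  obtain ⟨x, hx⟩ := x
  simp only [Subtype.forall, Subtype.exists, Subtype.mk.injEq]
  have key : ∀ z ∈ V_ α, (∀ w ∈ V_ α, w ∈ z ↔ (w = x ∨ ∀ v ∈ V_ α, v ∈ w ↔ v = x)) ↔
      z = {x, {x}} := by
    intro z hz
    have : (∀ w ∈ V_ α, w ∈ z ↔ (w = x ∨ ∀ v ∈ V_ α, v ∈ w ↔ v = x)) ↔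
        ∀ w ∈ V_ α, w ∈ z ↔ (w = x ∨ w = {x}) :=
      forall₂_congr fun w hw => by rw [eq_singleton_iff_vonNeumann hx hw]
    rw [this]
    constructor
    · intro h
      ext w
      rw [ZFSet.mem_pair]
      refine ⟨fun hw => (h w (mem_vonNeumann_of_mem hw hz)).1 hw, fun hw => (h w ?_).2 hw⟩
      rcases hw with rfl | rfl
      exacts [hx, hα x hx]
    · rintro rfl w -
      exact ZFSet.mem_pair
  constructor
  · rintro ⟨z, hz, h, h'⟩
    rwa [← (key z hz).1 h]
  · have hp := pair_singleton_mem_vonNeumann hα hx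
    exact fun h => ⟨_, hp, (key _ hp).2 rfl, h⟩

/-- A disjoint union of `A` and `B`, with `x ∈ A` coded by `{x}` and `x ∈ B` by `{x, {x}}`. -/
noncomputable def join (α : Ordinal.{u}) (A B : ZFSet.{u}) : ZFSet.{u} :=
  ZFSet.sep (fun z => (∃ x ∈ A, z = {x}) ∨ ∃ x ∈ B, z = {x, {x}}) (V_ α)

theorem singleton_ne_pair_singleton (x y : ZFSet.{u}) : ({x} : ZFSet.{u}) ≠ {y, {y}} := by
  intro h
  have h₁ : y ∈ ({x} : ZFSet.{u}) := h ▸ ZFSet.mem_pair.2 (.inl rfl)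
  have h₂ : {y} ∈ ({x} : ZFSet.{u}) := h ▸ ZFSet.mem_pair.2 (.inr rfl)
  rw [ZFSet.mem_singleton] at h₁ h₂
  have h₃ : y ∈ ({y} : ZFSet.{u}) := ZFSet.mem_singleton.2 rfl
  rw [h₂, ← h₁] at h₃
  exact ZFSet.mem_irrefl y h₃

theorem pair_singleton_injective {x y : ZFSet.{u}} (h : ({x, {x}} : ZFSet.{u}) = {y, {y}}) :
    x = y := by
  have h₁ : x ∈ ({y, {y}} : ZFSet.{u}) := h ▸ ZFSet.mem_pair.2 (.inl rfl)
  have h₂ : y ∈ ({x, {x}} : ZFSet.{u}) := h ▸ ZFSet.mem_pair.2 (.inl rfl)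
  rw [ZFSet.mem_pair] at h₁ h₂
  rcases h₁ with h₁ | h₁
  · exact h₁
  rcases h₂ with h₂ | h₂
  · exact h₂.symm
  refine (ZFSet.mem_asymm (x := x) (y := y) ?_ ?_).elim
  · rw [h₂]; exact ZFSet.mem_singleton.2 rfl
  · rw [h₁]; exact ZFSet.mem_singleton.2 rfl

theorem singleton_mem_join {α : Ordinal.{u}} {A B x : ZFSet.{u}} :
    {x} ∈ join α A B ↔ {x} ∈ V_ α ∧ x ∈ A := by
  rw [join, ZFSet.mem_sep]
  refine and_congr_right fun _ => ⟨?_, fun h => .inl ⟨x, h, rfl⟩⟩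
  rintro (⟨y, hy, h⟩ | ⟨y, -, h⟩)
  · rwa [ZFSet.singleton_injective h]
  · exact (singleton_ne_pair_singleton _ _ h).elim

theorem pair_mem_join {α : Ordinal.{u}} {A B x : ZFSet.{u}} :
    {x, {x}} ∈ join α A B ↔ {x, {x}} ∈ V_ α ∧ x ∈ B := by
  rw [join, ZFSet.mem_sep]
  refine and_congr_right fun _ => ⟨?_, fun h => .inr ⟨x, h, rfl⟩⟩
  rintro (⟨y, -, h⟩ | ⟨y, hy, h⟩)
  · exact (singleton_ne_pair_singleton _ _ h.symm).elim
  · rwa [pair_singleton_injective h]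

/-- The definitions, from `join α A B` and further predicates, of `A`, `B` and these predicates. -/
def unjoin (k : ℕ) : Fin (k + 2) → (setLang (k + 1)).Formula (Fin 1) :=
  Fin.cons (singletonFormula k) (Fin.cons (pairFormula k) fun i => predFormula i.succ)

theorem interprets_unjoin {k : ℕ} {α κ : Ordinal.{u}} (hακ : α ≤ κ)
    (hα : ∀ x ∈ V_ α, {x} ∈ V_ α) (A B : ZFSet.{u}) (P : Fin k → ZFSet.{u}) :
    Interprets α (unjoin k)
      (fun i => (Fin.cons A (Fin.cons B P : Fin (k + 1) → ZFSet.{u}) :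
        Fin (k + 2) → ZFSet.{u}) i ∩ V_ α)
      (fun i => (Fin.cons (join κ A B) P : Fin (k + 1) → ZFSet.{u}) i ∩ V_ α) := by
  have hV := ZFSet.vonNeumann_subset_of_le hακ
  intro i x
  cases i using Fin.cases with
  | zero =>
    refine Iff.trans ?_ (realize_singletonFormula hα x).symm
    have h := hα _ x.2
    simp [singleton_mem_join, x.2, h, hV h]
  | succ i =>
    cases i using Fin.cases with
    | zero =>
      refine Iff.trans ?_ (realize_pairFormula hα x).symm
      have h := pair_singleton_mem_vonNeumann hα x.2
      simp [pair_mem_join, x.2, h, hV h]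
    | succ i =>
      exact (realize_predFormula i.succ α
        (fun i => (Fin.cons (join κ A B) P : Fin (k + 1) → ZFSet.{u}) i ∩ V_ α) x).symm

theorem IsRegularCardinal.singleton_mem {κ : Ordinal.{u}} (h : IsRegularCardinal κ) :
    ∀ x ∈ V_ κ, {x} ∈ V_ κ := by
  obtain ⟨c, hc, rfl⟩ := h
  intro x hx
  rw [ZFSet.mem_vonNeumann] at hx ⊢
  rw [ZFSet.rank_singleton]
  exact (Cardinal.isSuccLimit_ord hc.aleph0_le).succ_lt hx

theorem inter_vonNeumann_of_subset {κ : Ordinal.{u}} {A : ZFSet.{u}} (h : A ⊆ V_ κ) :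
    A ∩ V_ κ = A := by
  ext x
  rw [ZFSet.mem_inter]
  exact ⟨fun hx => hx.1, fun hx => ⟨hx, h hx⟩⟩

/-! ### Reflection and the ideal of non-indescribable sets -/

/-- Indescribability reflects formulas with any number of predicates. -/
theorem IsIndescribableSubset.exists_sat {n : ℕ} {κ : Ordinal.{u}} {S : Set Ordinal.{u}}
    (hS : IsIndescribableSubset n κ S) {k : ℕ} {φ : SOFormula k} (hφ : InLevel .pi n φ)
    (P : Fin k → ZFSet.{u}) (hP : ∀ i, P i ⊆ V_ κ) (h : Sat κ φ P) :
    ∃ α ∈ S, Sat α φ fun i => P i ∩ V_ α := by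
  match k with
  | 0 =>
    obtain ⟨φ', h₁, h₂⟩ := hφ.exists_rename.{u} (Fin.elim0 : Fin 0 → Fin 1)
    obtain ⟨α, hα, h₃⟩ := hS.2.2 ∅ φ' (ZFSet.empty_subset _) h₁
      ((h₂ _ _).2 (by convert h))
    exact ⟨α, hα, by convert (h₂ _ _).1 h₃⟩
  | 1 =>
    obtain ⟨α, hα, h₃⟩ := hS.2.2 (P 0) φ (hP 0) hφ
      (by convert h using 2 with i; exact congrArg P (Subsingleton.elim _ _))
    exact ⟨α, hα, by
      convert h₃ using 3 with i; exact congrArg P (Subsingleton.elim _ _)⟩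
  | k + 2 =>
    obtain ⟨φ', h₁, h₂⟩ := hφ.exists_of_interprets.{u} (unjoin k)
    -- Decoding is correct only where `V_ α` is closed under singletons. This is first-order, so it
    -- is reflected along with `φ'`.
    obtain ⟨χ, h₃, h₄⟩ := exists_and.{u} h₁ (InLevel.fo_level _ _ (singletonSentence _))
    have hPc : P = Fin.cons (P 0) (Fin.cons (P 1) fun i => P i.succ.succ : Fin (k + 1) → _) := by
      funext i
      refine Fin.cases rfl (fun i => Fin.cases rfl (fun i => rfl) i) i
    set Q : Fin (k + 1) → ZFSet.{u} := Fin.cons (join κ (P 0) (P 1)) fun i => P i.succ.succ with hQ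
    have hQκ : ∀ i, Q i ⊆ V_ κ := by
      intro i
      refine Fin.cases ?_ (fun i => hP _) i
      intro z hz
      rw [hQ, Fin.cons_zero, join, ZFSet.mem_sep] at hz
      exact hz.1
    have key : ∀ α ≤ κ, (∀ x ∈ V_ α, {x} ∈ V_ α) →
        (Sat α φ' (fun i => Q i ∩ V_ α) ↔ Sat α φ fun i => P i ∩ V_ α) := by
      intro α hακ hα
      have := interprets_unjoin hακ hα (P 0) (P 1) fun i => P i.succ.succ
      rw [← hPc] at this
      exact h₂ α _ _ this
    have hκ := hS.1.singleton_mem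
    have h₅ : Sat κ χ Q := by
      refine (h₄ _ _).2 ⟨?_, sat_singletonSentence.2 hκ⟩
      have := key κ le_rfl hκ
      simp only [inter_vonNeumann_of_subset, hP, hQκ] at this
      exact this.2 h
    obtain ⟨α, hα, h₆⟩ := IsIndescribableSubset.exists_sat hS h₃ Q hQκ h₅
    obtain ⟨h₇, h₈⟩ := (h₄ _ _).1 h₆
    exact ⟨α, hα, (key α (hS.2.1 hα).le (sat_singletonSentence.1 h₈)).1 h₇⟩

/-- `Π¹ₙ`-indescribability reflects `Σ¹ₙ₊₁` formulas. -/
theorem IsIndescribableSubset.exists_sat_sigma {n : ℕ} {κ : Ordinal.{u}} {S : Set Ordinal.{u}}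
    (hS : IsIndescribableSubset n κ S) {q : Kind} {m k : ℕ} {φ : SOFormula k}
    (hφ : InLevel q m φ) (hq : q = .sigma) (hm : m = n + 1)
    (P : Fin k → ZFSet.{u}) (hP : ∀ i, P i ⊆ V_ κ) (h : Sat κ φ P) :
    ∃ α ∈ S, Sat α φ fun i => P i ∩ V_ α := by
  induction hφ with
  | fo => cases hm
  | step hφ =>
    cases hm
    subst hq
    exact hS.exists_sat hφ P hP h
  | all => cases hq
  | ex _ ih =>
    obtain ⟨X, hX, h⟩ := h
    obtain ⟨α, hα, h'⟩ := ih hq hm (Fin.cons X P : Fin _ → ZFSet.{u})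
      (fun i => Fin.cases hX hP i) h
    -- The witness `X` was reflected as an extra predicate, so its restriction is a witness at `α`.
    refine ⟨α, hα, X ∩ V_ α, fun z hz => (ZFSet.mem_inter.1 hz).2, ?_⟩
    convert h' using 2 with i
    refine Fin.cases rfl (fun i => rfl) i

/-- If `φ` holds at `κ`, the set of `α ∈ S` at which `φ` holds is indescribable along with `S`. -/
theorem IsIndescribableSubset.sep {n : ℕ} {κ : Ordinal.{u}} {S : Set Ordinal.{u}}
    (hS : IsIndescribableSubset n κ S) {φ : SOFormula 1} (hφ : InLevel .pi n φ) {A : ZFSet.{u}}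
    (hA : A ⊆ V_ κ) (h : Sat κ φ fun _ => A) :
    IsIndescribableSubset n κ {α ∈ S | Sat α φ fun _ => A ∩ V_ α} := by
  refine ⟨hS.1, fun α hα => hS.2.1 hα.1, fun B ψ hB hψ h' => ?_⟩
  obtain ⟨φ₁, h₁, h₁'⟩ := hφ.exists_rename.{u} (fun _ => (0 : Fin 2))
  obtain ⟨ψ₁, h₂, h₂'⟩ := hψ.exists_rename.{u} (fun _ => (1 : Fin 2))
  obtain ⟨χ, h₃, h₃'⟩ := exists_and.{u} h₁ h₂
  obtain ⟨α, hα, h₄⟩ := hS.exists_sat h₃ ![A, B]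
    (by intro i; fin_cases i; exacts [hA, hB])
    ((h₃' _ _).2 ⟨(h₁' _ _).2 h, (h₂' _ _).2 h'⟩)
  rw [h₃', h₁', h₂'] at h₄
  exact ⟨α, ⟨hα, h₄.1⟩, h₄.2⟩

theorem IsIndescribableSubset.mono {n : ℕ} {κ : Ordinal.{u}} {S T : Set Ordinal.{u}}
    (hS : IsIndescribableSubset n κ S) (h : S ⊆ T) (hT : T ⊆ Set.Iio κ) :
    IsIndescribableSubset n κ T :=
  ⟨hS.1, hT, fun A φ hA hφ h' =>
    let ⟨α, hα, h''⟩ := hS.2.2 A φ hA hφ h'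
    ⟨α, h hα, h''⟩⟩

/-- The subsets of `κ` that are not indescribable form an ideal. -/
theorem IsIndescribableSubset.of_union {n : ℕ} {κ : Ordinal.{u}} {S T : Set Ordinal.{u}}
    (h : IsIndescribableSubset n κ (S ∪ T)) :
    IsIndescribableSubset n κ S ∨ IsIndescribableSubset n κ T := by
  by_contra! H
  obtain ⟨hS, hT⟩ := H
  refine hS ⟨h.1, Set.subset_union_left.trans h.2.1, fun A φ hA hφ hφ' => ?_⟩
  by_contra! H
  refine hT ((h.sep hφ hA hφ').mono ?_ (Set.subset_union_right.trans h.2.1))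
  rintro α ⟨hα | hα, hα'⟩
  · exact (H α hα hα').elim
  · exact hα

theorem EqMod.isIndescribableSubset {n : ℕ} {κ : Ordinal.{u}} {A B : Set Ordinal.{u}}
    (h : EqMod n κ A B) (hB : IsIndescribableSubset n κ B) : IsIndescribableSubset n κ A := by
  refine (IsIndescribableSubset.of_union (T := (A \ B) ∪ (B \ A))
    (hB.mono (fun α hα => ?_) ?_)).resolve_right h.2.2
  · by_cases hA : α ∈ A
    exacts [.inl hA, .inr (.inr ⟨hα, hA⟩)]
  · rintro α (hα | hα | hα)
    exacts [h.1 hα, h.1 hα.1, h.2.1 hα.1]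

/-! ### The trace operation under reflection -/

/-- Under `Refl`, the trace operation preserves indescribable subsets. -/
theorem Refl.tr {n : ℕ} {κ : Ordinal.{u}} (hκ : Refl n κ) {S : Set Ordinal.{u}}
    (hS : IsIndescribableSubset n κ S) : IsIndescribableSubset n κ (Tr n κ S) := by
  refine ⟨hS.1, fun α hα => hα.1, fun A φ hA hφ h => ?_⟩
  obtain ⟨γ, hγ, hγS⟩ := hκ.2 _ (hS.sep hφ hA h)
  refine ⟨γ, ⟨hγ, hγS.mono (fun α hα => ⟨hα.1.1, hα.2⟩) Set.inter_subset_right⟩, ?_⟩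
  by_contra hn
  obtain ⟨ψ, h₁, h₂⟩ := hφ.exists_not.{u}
  -- The negation `ψ` is `Σ¹ₙ`, hence `Σ¹ₙ₊₁`. It reflects below `γ` to a point of the separated
  -- set, where `φ` holds.
  obtain ⟨α, hα, h₃⟩ := hγS.exists_sat_sigma h₁.succ rfl rfl (fun _ => A ∩ V_ γ)
    (fun _ z hz => (ZFSet.mem_inter.1 hz).2) ((h₂ _ _).2 hn)
  refine (h₂ _ _).1 h₃ ?_
  have : A ∩ V_ γ ∩ V_ α = A ∩ V_ α := by
    ext z
    simp only [ZFSet.mem_inter]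
    exact ⟨fun h => ⟨h.1.1, h.2⟩,
      fun h => ⟨⟨h.1, ZFSet.vonNeumann_subset_of_le (le_of_lt hα.2) h.2⟩, h.2⟩⟩
  rw [this]
  exact hα.1.2

theorem tr_Iio (n : ℕ) (κ : Ordinal.{u}) : Tr n κ (Set.Iio κ) = Ind n κ := by
  ext α
  refine and_congr_right fun h => ?_
  rw [Set.inter_eq_right.2 (Set.Iio_subset_Iio h.le), IsIndescribable]

end Indescribability

theorem lemma3p2 (n : ℕ) (κ : Ordinal.{u}) (hκ : Indescribability.Refl n κ) :
    Indescribability.IsIndescribableSubset n κ (Indescribability.Ind n κ) ∧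
    (∀ m : ℕ, Indescribability.IsIndescribableSubset n κ
      ((Indescribability.Tr n κ)^[m] (Indescribability.Ind n κ))) ∧
    Indescribability.IsOmegaIndescribable n κ := by
  have h : Indescribability.IsIndescribableSubset n κ (Indescribability.Ind n κ) :=
    Indescribability.tr_Iio n κ ▸ hκ.tr hκ.1
  refine ⟨h, fun m => ?_, fun m A hA => ?_⟩
  · induction m with
    | zero => exact h
    | succ m ih =>
      rw [Function.iterate_succ_apply']
      exact hκ.tr ih
  -- Positivity is carried from each representative to the next, so it is not needed that `Tr`
  -- respects equivalence.
  · induction hA with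
    | zero h => exact h.isIndescribableSubset hκ.1
    | succ _ h ih => exact h.isIndescribableSubset (hκ.tr ih)
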